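/- Let $f:\mathbb R^n\to\mathbb R^n$ and $g:\mathbb R^n\to\mathbb R^{n\times m}$ be locally Lipschitz, let $h:\mathbb R^n\to\mathbb R$ be continuously differentiable with $\mathcal C=\{x: h(x)\ge 0\}$, and let $\alpha:\mathbb R\to\mathbb R$ be continuous and strictly increasing with $\alpha(0)=0$ and $\alpha(r)\to\pm\infty$ as $r\to\pm\infty$. Write $L_fh(x)=\frac{\partial h}{\partial x}(x)f(x)$ and $L_gh(x)=\frac{\partial h}{\partial x}(x)g(x)$. Assume that $L_fh$, $L_gh$ and $\alpha\circ h$ are locally Lipschitz on $\mathbb R^n$, and Lipschitz on $\mathcal C$ with coefficients $\mathfrak L_{L_fh},\mathfrak L_{L_gh},\mathfrak L_{\alpha\circ h}\ge 0$ respectively. Let the desired controller $k_d:\mathbb R^n\to\mathbb R^m$, the measurement map $p:\mathbb R^n\to\mathbb R^k$, the state estimator $\widehat q:\mathbb R^k\to\mathbb R^n$ and the error bound $\epsilon:\mathbb R^k\to[0,\infty)$ be locally Lipschitz, and let $\rho>0$. For $y\in\mathbb R^k$ and $\widehat x\in\mathbb R^n$ consider the relaxed second-order cone program (R-MR-OP)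 $$\min_{(u,\delta)\in\mathbb R^m\times\mathbb R}\ \tfrac12\|u-k_d(\widehat x)\|_2^2+\rho\,\delta^2$$ subject to $$L_fh(\widehat x)-(\mathfrak L_{L_fh}+\mathfrak L_{\alpha\circ h})\epsilon(y)+L_gh(\widehat x)u-\mathfrak L_{L_gh}\,\epsilon(y)\|u\|_2\ \ge\ -\alpha(h(\widehat x))-\delta .$$ Then for every $(y,\widehat x)\in\mathbb R^k\times\mathbb R^n$ this program is feasible and has exactly one minimizer $(u^\star,\delta^\star)(y,\widehat x)$. If moreover $\epsilon(y)\ne 0$ for all $y\in p(\mathcal C)$, then the controller $x\mapsto u^\star\bigl(p(x),\widehat q(p(x))\bigr)$ and the slack $x\mapsto \delta^\star\bigl(p(x),\widehat q(p(x))\bigr)$ are locally Lipschitz continuous functions of the true state $x\in\mathbb R^n$. -/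

import Mathlib

open Filter Topology
open scoped NNReal

/-- `ℝ^d` with the Euclidean norm. -/
abbrev E (d : ℕ) : Type := EuclideanSpace ℝ (Fin d)

/-- Extended class `𝒦_∞`: continuous, strictly increasing functions `ℝ → ℝ` vanishing at `0` and
tending to `±∞` at `±∞`. -/
structure IsExtendedClassKInfty (α : ℝ → ℝ) : Prop where
  continuous : Continuous α
  map_zero : α 0 = 0
  strictMono : StrictMono α
  tendsto_atTop : Tendsto α atTop atTop
  tendsto_atBot : Tendsto α atBot atBot

/-- The data of the relaxed measurement-robust problem (no properties are imposed here). -/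
structure RobustFilterData (n m k : ℕ) where
  /-- drift of the control-affine system `ẋ = f x + g x u` -/
  f : E n → E n
  /-- input matrix, as a linear map `ℝ^m → ℝ^n` -/
  g : E n → (E m →L[ℝ] E n)
  /-- the function whose `0`-superlevel set is the safe set -/
  h : E n → ℝ
  /-- comparison function of the barrier condition -/
  α : ℝ → ℝ
  /-- desired controller -/
  kd : E n → E m
  /-- measurement-dependent bound on the estimation error -/
  ε : E k → ℝ≥0
  /-- Lipschitz coefficient of `L_f h` on the safe set -/
  lipF : ℝ≥0
  /-- Lipschitz coefficient of `L_g h` on the safe set -/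
  lipG : ℝ≥0
  /-- Lipschitz coefficient of `α ∘ h` on the safe set -/
  lipA : ℝ≥0
  /-- weight of the slack variable in the cost -/
  penalty : ℝ

namespace RobustFilterData

variable {n m k : ℕ} (D : RobustFilterData n m k)

/-- The safe set `{x | h x ≥ 0}`. -/
def safeSet : Set (E n) := {x | 0 ≤ D.h x}

/-- `L_f h (x) = (∂h/∂x)(x) f(x)`. -/
noncomputable def lieF (x : E n) : ℝ := fderiv ℝ D.h x (D.f x)

/-- The row vector `L_g h (x) = (∂h/∂x)(x) g(x)`, as a linear functional on `ℝ^m`; its operator norm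
is the Euclidean norm of the row vector. -/
noncomputable def lieG (x : E n) : E m →L[ℝ] ℝ := (fderiv ℝ D.h x).comp (D.g x)

/-- The cost `½ ‖u - k_d(x̂)‖² + penalty * δ²` of `w = (u, δ)` at the state estimate `x̂`. -/
noncomputable def cost (xhat : E n) (w : E m × ℝ) : ℝ :=
  1 / 2 * ‖w.1 - D.kd xhat‖ ^ 2 + D.penalty * w.2 ^ 2

/-- The pairs `w = (u, δ)` that satisfy the relaxed second-order cone constraint at the measurement
`y` and the state estimate `x̂`. -/
def feasibleSet (y : E k) (xhat : E n) : Set (E m × ℝ) :=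
  {w | D.lieF xhat - (D.lipF + D.lipA) * D.ε y + D.lieG xhat w.1 - D.lipG * D.ε y * ‖w.1‖
      ≥ -D.α (D.h xhat) - w.2}

/-- The set of minimizers of the cost over the feasible set. -/
def argmin (y : E k) (xhat : E n) : Set (E m × ℝ) :=
  {w | w ∈ D.feasibleSet y xhat ∧ IsMinOn (D.cost xhat) (D.feasibleSet y xhat) w}

/-- The minimizer `(u, δ)` at `(y, x̂)` (an element of `argmin` whenever there is one). -/
noncomputable def solution (y : E k) (xhat : E n) : E m × ℝ :=
  Classical.epsilon fun w => w ∈ D.argmin y xhat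

/-- The controller: the input component `u` of the minimizer. -/
noncomputable def controller (y : E k) (xhat : E n) : E m := (D.solution y xhat).1

/-- The slack component `δ` of the minimizer. -/
noncomputable def slack (y : E k) (xhat : E n) : ℝ := (D.solution y xhat).2

end RobustFilterData

/-! Since `δ` is free, `u = 0` with large slack is always feasible; the cost is coercive and
strongly convex in `(u, δ)` because `r > 0`, and the feasible set is closed and convex for `l ≥ 0`.
This gives a unique minimizer. For stability no constraint qualification is needed: a minimizer for
one parameter becomes feasible for another once its slack absorbs the change of margin. Adding the
two variational inequalities bounds the squared displacement by parameter change times displacement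
(`sq_norm_sub_add_le`). Dividing gives a Lipschitz bound on bounded parameter sets, and the
parameters are locally Lipschitz in the state. -/

section RelaxedConeProgram

variable {V : Type*} [NormedAddCommGroup V] [InnerProductSpace ℝ V]

/-- The parameters `(a, c, b, l)` of the relaxed second-order cone program: minimize
`½ ‖u - a‖² + r δ²` over the pairs `(u, δ)` with `0 ≤ b + c u - l ‖u‖ + δ`. -/
abbrev ConeParams (V : Type*) [NormedAddCommGroup V] [InnerProductSpace ℝ V] : Type _ :=
  V × (V →L[ℝ] ℝ) × ℝ × ℝ

namespace ConeParams

/-- The left-hand side of the cone constraint without slack. -/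
noncomputable def margin (θ : ConeParams V) (u : V) : ℝ := θ.2.2.1 + θ.2.1 u - θ.2.2.2 * ‖u‖

/-- The pairs that satisfy the relaxed cone constraint. -/
def feasible (θ : ConeParams V) : Set (V × ℝ) := {w | 0 ≤ θ.margin w.1 + w.2}

/-- The cost with slack weight `r`. -/
noncomputable def cost (r : ℝ) (θ : ConeParams V) (w : V × ℝ) : ℝ :=
  1 / 2 * ‖w.1 - θ.1‖ ^ 2 + r * w.2 ^ 2

/-- The minimizers of the program. -/
def argmin (r : ℝ) (θ : ConeParams V) : Set (V × ℝ) :=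
  {w | w ∈ θ.feasible ∧ IsMinOn (θ.cost r) θ.feasible w}

variable {θ θ' : ConeParams V} {r : ℝ} {w w' : V × ℝ}

/-! ### Existence of minimizers -/

theorem zero_mem_feasible : ((0, -θ.2.2.1) : V × ℝ) ∈ θ.feasible := by
  simp [feasible, margin]

theorem convex_feasible (hl : 0 ≤ θ.2.2.2) : Convex ℝ θ.feasible := by
  intro x hx y hy s t hs ht hst
  simp only [feasible, margin, Set.mem_ofPred_eq, Prod.fst_add, Prod.snd_add, Prod.smul_fst,
    Prod.smul_snd, map_add, map_smul, smul_eq_mul] at *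
  have hn : ‖s • x.1 + t • y.1‖ ≤ s * ‖x.1‖ + t * ‖y.1‖ := by
    refine (norm_add_le _ _).trans (le_of_eq ?_)
    rw [norm_smul, norm_smul, Real.norm_of_nonneg hs, Real.norm_of_nonneg ht]
  have h1 := mul_le_mul_of_nonneg_left hn hl
  have h2 := mul_nonneg hs hx
  have h3 := mul_nonneg ht hy
  have h4 : θ.2.2.1 = s * θ.2.2.1 + t * θ.2.2.1 := by rw [← add_mul, hst, one_mul]
  linarith

theorem isClosed_feasible : IsClosed θ.feasible := by
  unfold feasible margin
  exact isClosed_le continuous_const (by fun_prop)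

theorem continuous_cost : Continuous (θ.cost r) := by
  unfold cost
  fun_prop

theorem argmin_nonempty [FiniteDimensional ℝ V] (hr : 0 < r) : (θ.argmin r).Nonempty := by
  set M := θ.cost r (0, -θ.2.2.1)
  have hM : 0 ≤ M := by simp only [M, cost]; positivity
  -- Both cost terms are nonnegative, so each is at most `M`; this traps the sublevel set in a
  -- product of balls.
  have hbdd : Bornology.IsBounded {w : V × ℝ | θ.cost r w ≤ M} := by
    refine ((Metric.isBounded_closedBall (x := θ.1) (r := √(2 * M))).prod
      (Metric.isBounded_closedBall (x := (0 : ℝ)) (r := √(M / r)))).subset fun w hw => ?_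
    simp only [cost, Set.mem_ofPred_eq] at hw
    have h1 : 0 ≤ r * w.2 ^ 2 := by positivity
    have h2 : 0 ≤ 1 / 2 * ‖w.1 - θ.1‖ ^ 2 := by positivity
    refine ⟨?_, ?_⟩
    · rw [mem_closedBall_iff_norm]
      exact Real.le_sqrt_of_sq_le (by linarith)
    · rw [mem_closedBall_iff_norm, sub_zero]
      refine Real.le_sqrt_of_sq_le ?_
      rw [Real.norm_eq_abs, sq_abs, le_div_iff₀ hr]
      linarith
  have hK : IsCompact (θ.feasible ∩ {w : V × ℝ | θ.cost r w ≤ M}) :=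
    Metric.isCompact_of_isClosed_isBounded
      (isClosed_feasible.inter (isClosed_le continuous_cost continuous_const))
      (hbdd.subset Set.inter_subset_right)
  obtain ⟨w, ⟨hw, hwM⟩, hmin⟩ := hK.exists_isMinOn ⟨_, zero_mem_feasible, le_refl M⟩
    continuous_cost.continuousOn
  refine ⟨w, hw, fun v hv => ?_⟩
  by_cases h : θ.cost r v ≤ M
  · exact hmin ⟨hv, h⟩
  · exact le_trans hwM (not_le.mp h).le

/-! ### Comparison of minimizers for two parameters -/

/-- The first-order optimality condition of the program. -/
theorem variational_inequality (hl : 0 ≤ θ.2.2.2) (hw : w ∈ θ.argmin r) (hw' : w' ∈ θ.feasible) :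
    0 ≤ inner ℝ (w.1 - θ.1) (w'.1 - w.1) + 2 * r * w.2 * (w'.2 - w.2) := by
  set Q := 1 / 2 * ‖w'.1 - w.1‖ ^ 2 + r * (w'.2 - w.2) ^ 2 with hQ
  set J := inner ℝ (w.1 - θ.1) (w'.1 - w.1) + 2 * r * w.2 * (w'.2 - w.2) with hJ
  -- Expand the cost along the segment from `w` to `w'` and divide the increment by `t`; then `t →
  -- 0⁺` removes `Q`.
  have key : ∀ t ∈ Set.Ioc (0 : ℝ) 1, 0 ≤ J + t * Q := by
    intro t ht
    have hmem := (convex_feasible hl).add_smul_sub_mem hw.1 hw' ⟨ht.1.le, ht.2⟩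
    have hmin : θ.cost r w ≤ θ.cost r (w + t • (w' - w)) := hw.2 hmem
    have hexp : ‖w.1 + t • (w'.1 - w.1) - θ.1‖ ^ 2 = ‖w.1 - θ.1‖ ^ 2
        + 2 * (t * inner ℝ (w.1 - θ.1) (w'.1 - w.1)) + t ^ 2 * ‖w'.1 - w.1‖ ^ 2 := by
      rw [add_sub_right_comm, norm_add_sq_real, inner_smul_right, norm_smul, mul_pow,
        Real.norm_eq_abs, sq_abs]
    simp only [cost, Prod.fst_add, Prod.snd_add, Prod.smul_fst, Prod.smul_snd, Prod.fst_sub,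
      Prod.snd_sub, smul_eq_mul, hexp] at hmin
    have : 0 ≤ t * (J + t * Q) := by rw [hJ, hQ]; linarith
    exact nonneg_of_mul_nonneg_right this ht.1
  have hlim : Tendsto (fun t : ℝ => J + t * Q) (𝓝[>] 0) (𝓝 (J + 0 * Q)) :=
    Tendsto.mono_left (Continuous.tendsto (by fun_prop) 0) nhdsWithin_le_nhds
  rw [zero_mul, add_zero] at hlim
  refine ge_of_tendsto hlim ?_
  filter_upwards [Ioc_mem_nhdsGT zero_lt_one] with t ht using key t ht

/-- Changing the parameters changes the margin by at most a multiple of the change. -/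
theorem abs_margin_sub_le (u : V) :
    |θ.margin u - θ'.margin u| ≤ ‖θ - θ'‖ * (1 + 2 * ‖u‖) := by
  have h1 : ‖θ.2.2.1 - θ'.2.2.1‖ ≤ ‖θ - θ'‖ :=
    (norm_fst_le (θ - θ').2.2).trans ((norm_snd_le _).trans (norm_snd_le _))
  have h2 : ‖θ.2.2.2 - θ'.2.2.2‖ ≤ ‖θ - θ'‖ :=
    (norm_snd_le (θ - θ').2.2).trans ((norm_snd_le _).trans (norm_snd_le _))
  have h3 : ‖θ.2.1 - θ'.2.1‖ ≤ ‖θ - θ'‖ := (norm_fst_le (θ - θ').2).trans (norm_snd_le _)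
  have e : θ.margin u - θ'.margin u = (θ.2.2.1 - θ'.2.2.1) + (θ.2.1 - θ'.2.1) u
      - (θ.2.2.2 - θ'.2.2.2) * ‖u‖ := by
    simp only [margin, sub_apply]; ring
  have h4 := (θ.2.1 - θ'.2.1).le_of_opNorm_le h3 u
  have h5 := mul_le_mul_of_nonneg_right h2 (norm_nonneg u)
  rw [Real.norm_eq_abs] at h1 h4 h5
  rw [abs_le] at h1 h4
  have h6 : |(θ.2.2.2 - θ'.2.2.2) * ‖u‖| ≤ ‖θ - θ'‖ * ‖u‖ := by rwa [abs_mul, abs_norm]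
  rw [abs_le] at h6
  rw [e, abs_le]
  constructor <;> linarith

/-- The change of the margin under a change of parameters is Lipschitz in the input. -/
theorem margin_mixed_difference_le (u v : V) :
    |(θ.margin v - θ'.margin v) - (θ.margin u - θ'.margin u)| ≤ 2 * ‖θ - θ'‖ * ‖v - u‖ := by
  have h2 : ‖θ.2.2.2 - θ'.2.2.2‖ ≤ ‖θ - θ'‖ :=
    (norm_snd_le (θ - θ').2.2).trans ((norm_snd_le _).trans (norm_snd_le _))
  have h3 : ‖θ.2.1 - θ'.2.1‖ ≤ ‖θ - θ'‖ := (norm_fst_le (θ - θ').2).trans (norm_snd_le _)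
  have e : (θ.margin v - θ'.margin v) - (θ.margin u - θ'.margin u) = (θ.2.1 - θ'.2.1) (v - u)
      - (θ.2.2.2 - θ'.2.2.2) * (‖v‖ - ‖u‖) := by
    simp only [margin, sub_apply, map_sub]; ring
  have h4 := (θ.2.1 - θ'.2.1).le_of_opNorm_le h3 (v - u)
  rw [Real.norm_eq_abs] at h2 h4
  have h6 : |(θ.2.2.2 - θ'.2.2.2) * (‖v‖ - ‖u‖)| ≤ ‖θ - θ'‖ * ‖v - u‖ := by
    rw [abs_mul]
    exact mul_le_mul h2 (abs_norm_sub_norm_le v u) (abs_nonneg _) (norm_nonneg _)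
  rw [e]
  refine (abs_sub _ _).trans ?_
  linarith

/-- Every term on the right must carry a displacement factor, else only Hölder-1/2 dependence
follows; the mixed-difference bound secures this. -/
theorem sq_norm_sub_add_le (hr : 0 < r) (hl : 0 ≤ θ.2.2.2) (hl' : 0 ≤ θ'.2.2.2)
    (hw : w ∈ θ.argmin r) (hw' : w' ∈ θ'.argmin r) :
    ‖w'.1 - w.1‖ ^ 2 + 2 * r * (w'.2 - w.2) ^ 2 ≤
      ‖θ - θ'‖ * (‖w'.1 - w.1‖ * (1 + 4 * r * |w.2|)
        + 2 * r * (1 + 2 * ‖w.1‖) * |w'.2 - w.2|) := by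
  have v1 := variational_inequality hl hw
    (w' := (w'.1, w'.2 - (θ.margin w'.1 - θ'.margin w'.1))) (by
      have := hw'.1
      simp only [feasible, Set.mem_ofPred_eq] at this ⊢
      linarith)
  have v2 := variational_inequality hl' hw'
    (w' := (w.1, w.2 + (θ.margin w.1 - θ'.margin w.1))) (by
      have := hw.1
      simp only [feasible, Set.mem_ofPred_eq] at this ⊢
      linarith)
  have hmix := margin_mixed_difference_le (θ := θ) (θ' := θ') w.1 w'.1
  have hdiff := abs_margin_sub_le (θ := θ) (θ' := θ') w.1
  dsimp only at v1 v2
  set e' := θ.margin w'.1 - θ'.margin w'.1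
  set e := θ.margin w.1 - θ'.margin w.1
  set T := ‖θ - θ'‖
  have hin : inner ℝ (w.1 - θ.1) (w'.1 - w.1) + inner ℝ (w'.1 - θ'.1) (w.1 - w'.1)
      = inner ℝ (θ'.1 - θ.1) (w'.1 - w.1) - ‖w'.1 - w.1‖ ^ 2 := by
    rw [← neg_sub w'.1 w.1, inner_neg_right, ← sub_eq_add_neg, ← inner_sub_left,
      ← real_inner_self_eq_norm_sq, ← inner_sub_left]
    congr 1
    abel
  have hkd : inner ℝ (θ'.1 - θ.1) (w'.1 - w.1) ≤ T * ‖w'.1 - w.1‖ := by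
    refine (real_inner_le_norm _ _).trans (mul_le_mul_of_nonneg_right ?_ (norm_nonneg _))
    rw [norm_sub_rev]
    exact norm_fst_le (θ - θ')
  -- The slack corrections contribute `w'.2 * e - w.2 * e'`, split as `w.2 * (e - e') + (w'.2 - w.2)
  -- * e`.
  have b1 : w.2 * (e - e') ≤ |w.2| * (2 * T * ‖w'.1 - w.1‖) := by
    refine (le_abs_self _).trans ?_
    rw [abs_mul, abs_sub_comm]
    exact mul_le_mul_of_nonneg_left hmix (abs_nonneg _)
  have b2 : (w'.2 - w.2) * e ≤ |w'.2 - w.2| * (T * (1 + 2 * ‖w.1‖)) := by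
    refine (le_abs_self _).trans ?_
    rw [abs_mul]
    exact mul_le_mul_of_nonneg_left hdiff (abs_nonneg _)
  have b3 := mul_le_mul_of_nonneg_left (add_le_add b1 b2) (by positivity : 0 ≤ 2 * r)
  linarith

/-- The comparison estimate with equal parameters has right-hand side zero. -/
theorem argmin_unique (hr : 0 < r) (hl : 0 ≤ θ.2.2.2)
    (hw : w ∈ θ.argmin r) (hw' : w' ∈ θ.argmin r) : w = w' := by
  have h := sq_norm_sub_add_le hr hl hl hw hw'
  rw [sub_self, norm_zero, zero_mul] at h
  have h1 : 0 ≤ 2 * r * (w'.2 - w.2) ^ 2 := by positivity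
  have h2 : ‖w'.1 - w.1‖ ^ 2 = 0 := le_antisymm (by linarith) (by positivity)
  have h3 : 2 * r * (w'.2 - w.2) ^ 2 = 0 := le_antisymm (by linarith [sq_nonneg ‖w'.1 - w.1‖]) h1
  rw [mul_eq_zero, or_iff_right (by positivity)] at h3
  exact Prod.ext (sub_eq_zero.mp (norm_eq_zero.mp (pow_eq_zero_iff two_ne_zero |>.mp h2))).symm
    (sub_eq_zero.mp (pow_eq_zero_iff two_ne_zero |>.mp h3)).symm

/-! ### Lipschitz dependence on the parameters -/

/-- Minimizers are bounded in terms of the parameters. -/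
theorem norm_le_of_mem_argmin (hr : 0 < r) {R : ℝ} (hR : ‖θ‖ ≤ R) (hw : w ∈ θ.argmin r) :
    ‖w.1‖ ≤ R + √(R ^ 2 + 2 * r * R ^ 2) ∧ |w.2| ≤ √((1 / 2 * R ^ 2 + r * R ^ 2) / r) := by
  have ha : ‖θ.1‖ ≤ R := (norm_fst_le θ).trans hR
  have hb : ‖θ.2.2.1‖ ≤ R :=
    (norm_fst_le θ.2.2).trans ((norm_snd_le _).trans ((norm_snd_le θ).trans hR))
  have h : θ.cost r w ≤ θ.cost r (0, -θ.2.2.1) := hw.2 zero_mem_feasible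
  simp only [cost, zero_sub, norm_neg, neg_sq] at h
  have ha2 : ‖θ.1‖ ^ 2 ≤ R ^ 2 := by gcongr
  have hb2 : r * θ.2.2.1 ^ 2 ≤ r * R ^ 2 := by
    rw [← sq_abs θ.2.2.1, ← Real.norm_eq_abs]; gcongr
  have h1 : 0 ≤ r * w.2 ^ 2 := by positivity
  have h2 : 0 ≤ 1 / 2 * ‖w.1 - θ.1‖ ^ 2 := by positivity
  refine ⟨?_, ?_⟩
  · have h3 : ‖w.1 - θ.1‖ ≤ √(R ^ 2 + 2 * r * R ^ 2) := Real.le_sqrt_of_sq_le (by linarith)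
    have h4 := norm_add_le θ.1 (w.1 - θ.1)
    rw [add_sub_cancel] at h4
    linarith
  · refine Real.abs_le_sqrt ?_
    rw [le_div_iff₀ hr]
    linarith

/-- On bounded sets of parameters, minimizers depend on the parameters in a Lipschitz way. -/
theorem exists_lipschitz_bound (hr : 0 < r) (R : ℝ) : ∃ C : ℝ≥0, ∀ θ θ' : ConeParams V,
    ‖θ‖ ≤ R → 0 ≤ θ.2.2.2 → 0 ≤ θ'.2.2.2 → ∀ w ∈ θ.argmin r, ∀ w' ∈ θ'.argmin r,
      dist w w' ≤ C * dist θ θ' := by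
  set M₁ := R + √(R ^ 2 + 2 * r * R ^ 2)
  set M₂ := √((1 / 2 * R ^ 2 + r * R ^ 2) / r)
  set B := 1 + 4 * r * M₂ + 2 * r * (1 + 2 * M₁)
  -- The product carries the sup norm, so the weighted sum of squares dominates `min 1 (2 * r)`
  -- times the squared norm.
  have hc : 0 < min 1 (2 * r) := lt_min one_pos (by positivity)
  refine ⟨(B / min 1 (2 * r)).toNNReal, fun θ θ' hR hl hl' w hw w' hw' => ?_⟩
  obtain ⟨h1, h2⟩ := norm_le_of_mem_argmin hr hR hw
  change ‖w.1‖ ≤ M₁ at h1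
  change |w.2| ≤ M₂ at h2
  have h := sq_norm_sub_add_le hr hl hl' hw hw'
  refine le_trans ?_ (mul_le_mul_of_nonneg_right (Real.le_coe_toNNReal _) dist_nonneg)
  rw [dist_comm w, dist_eq_norm, dist_eq_norm, div_mul_eq_mul_div, le_div_iff₀ hc]
  have hA : ‖w'.1 - w.1‖ ≤ ‖w' - w‖ := norm_fst_le (w' - w)
  have hB : |w'.2 - w.2| ≤ ‖w' - w‖ := norm_snd_le (w' - w)
  have hM : 0 ≤ M₁ := (norm_nonneg _).trans h1
  have hM' : 0 ≤ M₂ := (abs_nonneg _).trans h2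
  have hup : ‖w'.1 - w.1‖ * (1 + 4 * r * |w.2|) + 2 * r * (1 + 2 * ‖w.1‖) * |w'.2 - w.2|
      ≤ ‖w' - w‖ * B :=
    calc _ ≤ ‖w' - w‖ * (1 + 4 * r * M₂) + 2 * r * (1 + 2 * M₁) * ‖w' - w‖ := by gcongr
      _ = ‖w' - w‖ * B := by ring
  have hlow : min 1 (2 * r) * ‖w' - w‖ ^ 2 ≤ ‖w'.1 - w.1‖ ^ 2 + 2 * r * (w'.2 - w.2) ^ 2 := by
    have h5 : 0 ≤ ‖w'.1 - w.1‖ ^ 2 := by positivity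
    have h6 : 0 ≤ 2 * r * (w'.2 - w.2) ^ 2 := by positivity
    rcases max_choice ‖(w' - w).1‖ ‖(w' - w).2‖ with hm | hm
    · rw [Prod.norm_def, hm, Prod.fst_sub]
      have := mul_le_mul_of_nonneg_right (min_le_left 1 (2 * r)) h5
      linarith
    · rw [Prod.norm_def, hm, Prod.snd_sub, Real.norm_eq_abs, sq_abs]
      have := mul_le_mul_of_nonneg_right (min_le_right 1 (2 * r)) (sq_nonneg (w'.2 - w.2))
      linarith
  rcases (norm_nonneg (w' - w)).eq_or_lt with h0 | h0
  · rw [← h0, zero_mul]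
    have : 0 ≤ B := by positivity
    positivity
  · refine le_of_mul_le_mul_right ?_ h0
    have := mul_le_mul_of_nonneg_left hup (norm_nonneg (θ - θ'))
    linarith

/-- Minimizers along a locally Lipschitz family of parameters are locally Lipschitz. -/
theorem locallyLipschitz_minimizer {X : Type*} [PseudoMetricSpace X] (hr : 0 < r)
    {Θ : X → ConeParams V} (hΘ : LocallyLipschitz Θ) (hl : ∀ x, 0 ≤ (Θ x).2.2.2)
    {W : X → V × ℝ} (hW : ∀ x, W x ∈ (Θ x).argmin r) : LocallyLipschitz W := by
  intro x
  obtain ⟨K, s, hs, hK⟩ := hΘ x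
  -- By continuity, `‖Θ x‖ + 1` bounds the parameters near `x`.
  obtain ⟨C, hC⟩ := exists_lipschitz_bound (V := V) hr (‖Θ x‖ + 1)
  have hnear : {y | ‖Θ y‖ < ‖Θ x‖ + 1} ∈ 𝓝 x :=
    (hΘ.continuous.norm.tendsto x).eventually_lt_const (lt_add_one _)
  refine ⟨C * K, _, inter_mem hs hnear, LipschitzOnWith.of_dist_le_mul fun y hy z hz => ?_⟩
  refine (hC _ _ hy.2.le (hl y) (hl z) _ (hW y) _ (hW z)).trans ?_
  rw [NNReal.coe_mul, mul_assoc]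
  exact mul_le_mul_of_nonneg_left (hK.dist_le_mul y hy.1 z hz.1) C.2

end ConeParams

end RelaxedConeProgram

/-! ### The robust filter as a cone program -/

namespace RobustFilterData

variable {n m k : ℕ} (D : RobustFilterData n m k)

/-- The parameters of the cone program solved at the measurement `y` and the estimate `x̂`. -/
noncomputable def coneParams (y : E k) (xhat : E n) : ConeParams (E m) :=
  (D.kd xhat, D.lieG xhat, D.lieF xhat - (D.lipF + D.lipA) * D.ε y + D.α (D.h xhat),
    D.lipG * D.ε y)

theorem feasibleSet_eq (y : E k) (xhat : E n) :
    D.feasibleSet y xhat = (D.coneParams y xhat).feasible := by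
  ext w
  simp only [feasibleSet, ConeParams.feasible, ConeParams.margin, coneParams, Set.mem_ofPred_eq]
  constructor <;> intro h <;> linarith

theorem argmin_eq (y : E k) (xhat : E n) :
    D.argmin y xhat = (D.coneParams y xhat).argmin D.penalty := by
  unfold argmin ConeParams.argmin
  rw [feasibleSet_eq]
  rfl

theorem coneParams_slope_nonneg (y : E k) (xhat : E n) : 0 ≤ (D.coneParams y xhat).2.2.2 :=
  mul_nonneg (NNReal.coe_nonneg _) (NNReal.coe_nonneg _)

theorem solution_mem_argmin (hr : 0 < D.penalty) (y : E k) (xhat : E n) :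
    D.solution y xhat ∈ (D.coneParams y xhat).argmin D.penalty := by
  rw [← argmin_eq]
  refine Classical.epsilon_spec (p := fun w => w ∈ D.argmin y xhat) ?_
  rw [argmin_eq]
  exact ConeParams.argmin_nonempty hr

theorem locallyLipschitz_coneParams (hLf : LocallyLipschitz D.lieF) (hLg : LocallyLipschitz D.lieG)
    (hαh : LocallyLipschitz (D.α ∘ D.h)) (hkd : LocallyLipschitz D.kd)
    (hε : LocallyLipschitz D.ε) {X : Type*} [PseudoMetricSpace X] {y : X → E k} {xhat : X → E n}
    (hy : LocallyLipschitz y) (hx : LocallyLipschitz xhat) :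
    LocallyLipschitz fun x => D.coneParams (y x) (xhat x) := by
  have hεr : LocallyLipschitz fun x => (D.ε (y x) : ℝ) :=
    (LipschitzWith.of_dist_le_mul (K := 1) (f := ((↑) : ℝ≥0 → ℝ))
      fun a b => by simp [NNReal.dist_eq, Real.dist_eq]).locallyLipschitz.comp (hε.comp hy)
  have hoff : LocallyLipschitz fun q : ℝ × ℝ × ℝ =>
      q.1 - ((D.lipF : ℝ) + D.lipA) * q.2.1 + q.2.2 :=
    ContDiff.locallyLipschitz (𝕂 := ℝ) (by fun_prop)
  have hslope : LocallyLipschitz fun q : ℝ => (D.lipG : ℝ) * q :=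
    ContDiff.locallyLipschitz (𝕂 := ℝ) (by fun_prop)
  exact (hkd.comp hx).prodMk ((hLg.comp hx).prodMk
    ((hoff.comp ((hLf.comp hx).prodMk (hεr.prodMk (hαh.comp hx)))).prodMk (hslope.comp hεr)))

end RobustFilterData

theorem mainTheorem5 {n m k : ℕ} (D : RobustFilterData n m k)
    (p : E n → E k) (qhat : E k → E n)
    (hf : LocallyLipschitz D.f) (hg : LocallyLipschitz D.g)
    (hh : ContDiff ℝ 1 D.h) (hα : IsExtendedClassKInfty D.α)
    (hlipF : LipschitzOnWith D.lipF D.lieF D.safeSet)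
    (hlipG : LipschitzOnWith D.lipG D.lieG D.safeSet)
    (hlipA : LipschitzOnWith D.lipA (D.α ∘ D.h) D.safeSet)
    (hLf : LocallyLipschitz D.lieF) (hLg : LocallyLipschitz D.lieG)
    (hαh : LocallyLipschitz (D.α ∘ D.h))
    (hkd : LocallyLipschitz D.kd) (hε : LocallyLipschitz D.ε)
    (hp : LocallyLipschitz p) (hqhat : LocallyLipschitz qhat)
    (hpenalty : 0 < D.penalty) :
    (∀ (y : E k) (xhat : E n),
      (D.feasibleSet y xhat).Nonempty ∧ ∃! w : E m × ℝ, w ∈ D.argmin y xhat) ∧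
    ((∀ y ∈ p '' D.safeSet, D.ε y ≠ 0) →
      LocallyLipschitz (fun x : E n => D.controller (p x) (qhat (p x))) ∧
      LocallyLipschitz (fun x : E n => D.slack (p x) (qhat (p x)))) := by
  refine ⟨fun y xhat => ⟨?_, ?_⟩, fun _ => ?_⟩
  · rw [D.feasibleSet_eq]
    exact ⟨_, ConeParams.zero_mem_feasible⟩
  · rw [D.argmin_eq]
    obtain ⟨w, hw⟩ := ConeParams.argmin_nonempty (θ := D.coneParams y xhat) hpenalty
    exact ⟨w, hw, fun v hv =>
      ConeParams.argmin_unique hpenalty (D.coneParams_slope_nonneg y xhat) hv hw⟩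
  · have hsol : LocallyLipschitz fun x : E n => D.solution (p x) (qhat (p x)) :=
      ConeParams.locallyLipschitz_minimizer hpenalty
        (D.locallyLipschitz_coneParams hLf hLg hαh hkd hε hp (hqhat.comp hp))
        (fun x => D.coneParams_slope_nonneg _ _) (fun x => D.solution_mem_argmin hpenalty _ _)
    exact ⟨LipschitzWith.prod_fst.locallyLipschitz.comp hsol,
      LipschitzWith.prod_snd.locallyLipschitz.comp hsol⟩
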